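/- Let $K$ be an algebraically closed field and $s\ge 1$ an integer. Let $\Gamma_s$ be the quiver with vertex set $\mathbb Z/s$ and, for each vertex $i$, two arrows $a_i,b_i\colon i\to i+1$. In the path algebra $K\Gamma_s$ (paths are composed from left to right, $e_i$ is the trivial path at $i$) put $x=\sum_i a_i$, $y=\sum_i b_i$, and let $$\Lambda_s=K\Gamma_s/\langle x^2,\;xy+yx,\;y^2\rangle .$$ All bimodules are $\Lambda_s$-$\Lambda_s$-bimodules on which $K$ acts centrally, that is, modules over the enveloping algebra $\Lambda_s^e$, and $\otimes=\otimes_K$. For $n\ge 0$ let $$Q^n=\bigoplus_{i\in\mathbb Z/s}\ \bigoplus_{j=0}^{n}\Lambda_s e_i\otimes e_{i+n}\Lambda_s ,$$ and let $b^n_{i,j}$ be the element $e_i\otimes e_{i+n}$ of the summand with index $(i,j)$; subscripts $i$ are taken modulo $s$. Let $\partial^0\colon Q^0\to\Lambda_s$ be the multiplication map, $u\otimes w\mapsto uw$ on every summand, and for $n\ge 1$ let $\partial^n\colon Q^n\to Q^{n-1}$ be the bimodule homomorphism determined by $$b^n_{i,0}\mapsto b^{n-1}_{i,0}\,y+(-1)^n\,y\,b^{n-1}_{i+1,0},\qquad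 b^n_{i,n}\mapsto b^{n-1}_{i,n-1}\,x+(-1)^n\,x\,b^{n-1}_{i+1,n-1},$$ $$b^n_{i,j}\mapsto \bigl(b^{n-1}_{i,j-1}\,x+b^{n-1}_{i,j}\,y\bigr)+(-1)^n\bigl(y\,b^{n-1}_{i+1,j}+x\,b^{n-1}_{i+1,j-1}\bigr)\qquad(1\le j\le n-1).$$ Then $(Q^\bullet,\partial^\bullet)$ is a minimal projective resolution of $\Lambda_s$ as a bimodule over itself. That is, the sequence $\cdots\to Q^2\xrightarrow{\partial^2}Q^1\xrightarrow{\partial^1}Q^0\xrightarrow{\partial^0}\Lambda_s\to 0$ is exact, $\partial^0$ is a projective cover of $\Lambda_s$, and for every $n\ge 1$ the map $\partial^n\colon Q^n\to\operatorname{Im}\partial^n$ is a projective cover. Here a projective cover of $M$ is an epimorphism $f\colon P\to M$ with $P$ projective such that $\operatorname{Ker}f$ is superfluous in $P$ (if $X$ is a submodule of $P$ with $\operatorname{Ker} f+X=P$, then $X=P$). -/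

import Mathlib

open scoped TensorProduct DirectSum

noncomputable section

/-! ### Path algebras -/

/-- The path algebra `K V` of a quiver with vertex set `V`: as a vector space it has the paths
as a basis. -/
def PathAlgebra (K V : Type*) [Field K] [Quiver V] : Type _ :=
  (Σ i j : V, Quiver.Path i j) →₀ K

namespace PathAlgebra

variable (K : Type*) {V : Type*} [Field K] [Quiver V]

instance : AddCommGroup (PathAlgebra K V) :=
  inferInstanceAs (AddCommGroup ((Σ i j : V, Quiver.Path i j) →₀ K))

instance : Module K (PathAlgebra K V) :=
  inferInstanceAs (Module K ((Σ i j : V, Quiver.Path i j) →₀ K))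

/-- The basis element of the path algebra given by a path. -/
def path {i j : V} (p : Quiver.Path i j) : PathAlgebra K V :=
  Finsupp.single (⟨i, j, p⟩ : Σ i j : V, Quiver.Path i j) (1 : K)

/-- The product of two paths: first `p`, then `q` if the terminus of `p` is the origin of `q`,
and `0` otherwise. -/
def pathMul [DecidableEq V] (p q : Σ i j : V, Quiver.Path i j) : PathAlgebra K V :=
  if h : q.1 = p.2.1 then path K (p.2.2.comp (q.2.2.cast h rfl)) else 0

/-- The linear map with prescribed values on the paths. -/
def lift {M : Type*} [AddCommGroup M] [Module K M] (f : (Σ i j : V, Quiver.Path i j) → M) :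
    PathAlgebra K V →ₗ[K] M :=
  Finsupp.linearCombination K f

theorem lift_path {M : Type*} [AddCommGroup M] [Module K M]
    (f : (Σ i j : V, Quiver.Path i j) → M) {i j : V} (p : Quiver.Path i j) :
    lift K f (path K p) = f ⟨i, j, p⟩ :=
  (Finsupp.linearCombination_single K (1 : K) _).trans (one_smul K _)

/-- The bilinear extension of the product of paths. -/
def mulHom [DecidableEq V] : PathAlgebra K V →ₗ[K] PathAlgebra K V →ₗ[K] PathAlgebra K V :=
  lift K fun p => lift K fun q => pathMul K p q

instance [DecidableEq V] : Mul (PathAlgebra K V) := ⟨fun f g => mulHom K f g⟩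

/-- The trivial path at a vertex. -/
def e (i : V) : PathAlgebra K V := path K (Quiver.Path.nil : Quiver.Path i i)

/-- An arrow, as an element of the path algebra. -/
def arrow {i j : V} (a : i ⟶ j) : PathAlgebra K V := path K a.toPath

instance [Fintype V] : One (PathAlgebra K V) := ⟨∑ i, e K i⟩

theorem mul_def [DecidableEq V] (f g : PathAlgebra K V) : f * g = mulHom K f g := rfl

theorem one_def [Fintype V] : (1 : PathAlgebra K V) = ∑ i, e K i := rfl

variable {K} in
theorem induction {P : PathAlgebra K V → Prop} (f : PathAlgebra K V) (h0 : P 0)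
    (hadd : ∀ f g, P f → P g → P (f + g))
    (hpath : ∀ (c : K) (i j : V) (p : Quiver.Path i j), P (c • path K p)) : P f := by
  refine Finsupp.induction_linear (motive := P) f h0 hadd ?_
  rintro ⟨i, j, p⟩ c
  have h : (Finsupp.single (⟨i, j, p⟩ : Σ i j : V, Quiver.Path i j) c) = c • path K p :=
    (Finsupp.smul_single_one _ c).symm
  exact h ▸ hpath c i j p

theorem mulHom_path [DecidableEq V] {i j k l : V} (p : Quiver.Path i j) (q : Quiver.Path k l) :
    mulHom K (path K p) (path K q) = pathMul K ⟨i, j, p⟩ ⟨k, l, q⟩ := by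
  rw [mulHom, lift_path, lift_path]

theorem path_mul_path [DecidableEq V] {i j l : V} (p : Quiver.Path i j) (q : Quiver.Path j l) :
    path K p * path K q = path K (p.comp q) := by
  rw [mul_def, mulHom_path]
  simp [pathMul]

theorem path_mul_path_of_ne [DecidableEq V] {i j k l : V} (p : Quiver.Path i j)
    (q : Quiver.Path k l) (h : k ≠ j) : path K p * path K q = 0 := by
  rw [mul_def, mulHom_path]
  simp [pathMul, h]

theorem pa_mul_add [DecidableEq V] (f g h : PathAlgebra K V) : f * (g + h) = f * g + f * h := by
  simp [mul_def]

theorem pa_add_mul [DecidableEq V] (f g h : PathAlgebra K V) : (f + g) * h = f * h + g * h := by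
  simp [mul_def]

theorem pa_mul_smul [DecidableEq V] (c : K) (f g : PathAlgebra K V) :
    f * (c • g) = c • (f * g) := by
  simp [mul_def]

theorem pa_smul_mul [DecidableEq V] (c : K) (f g : PathAlgebra K V) :
    (c • f) * g = c • (f * g) := by
  simp [mul_def]

theorem pa_zero_mul [DecidableEq V] (f : PathAlgebra K V) : 0 * f = 0 := by
  simp [mul_def]

theorem pa_mul_zero [DecidableEq V] (f : PathAlgebra K V) : f * 0 = 0 := by
  simp [mul_def]

theorem path_mul_assoc [DecidableEq V] {i j k l m n : V} (p : Quiver.Path i j)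
    (q : Quiver.Path k l) (r : Quiver.Path m n) :
    path K p * path K q * path K r = path K p * (path K q * path K r) := by
  by_cases h : k = j
  · subst h
    by_cases h' : m = l
    · subst h'
      simp only [path_mul_path, Quiver.Path.comp_assoc]
    · rw [path_mul_path_of_ne K q r h', path_mul_path, path_mul_path_of_ne K _ r h', pa_mul_zero]
  · rw [path_mul_path_of_ne K p q h, pa_zero_mul]
    by_cases h' : m = l
    · subst h'
      rw [path_mul_path, path_mul_path_of_ne K p _ h]
    · rw [path_mul_path_of_ne K q r h', pa_mul_zero]

theorem pa_mul_assoc [DecidableEq V] (f g h : PathAlgebra K V) : f * g * h = f * (g * h) := by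
  induction f using induction with
  | h0 => simp only [pa_zero_mul]
  | hadd f f' hf hf' => simp only [pa_add_mul, hf, hf']
  | hpath c i j p =>
    induction g using induction with
    | h0 => simp only [pa_zero_mul, pa_mul_zero]
    | hadd g g' hg hg' => simp only [pa_add_mul, pa_mul_add, hg, hg']
    | hpath c' k l q =>
      induction h using induction with
      | h0 => simp only [pa_mul_zero]
      | hadd h h' hh hh' => simp only [pa_mul_add, hh, hh']
      | hpath c'' m n r => simp only [pa_smul_mul, pa_mul_smul, path_mul_assoc]

theorem pa_sum_mul [DecidableEq V] {ι : Type*} (t : Finset ι) (u : ι → PathAlgebra K V)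
    (f : PathAlgebra K V) : (∑ i ∈ t, u i) * f = ∑ i ∈ t, u i * f := by
  simp [mul_def]

theorem pa_mul_sum [DecidableEq V] {ι : Type*} (t : Finset ι) (u : ι → PathAlgebra K V)
    (f : PathAlgebra K V) : f * (∑ i ∈ t, u i) = ∑ i ∈ t, f * u i := by
  simp [mul_def]

theorem pa_one_mul [DecidableEq V] [Fintype V] (f : PathAlgebra K V) : 1 * f = f := by
  induction f using induction with
  | h0 => exact pa_mul_zero K _
  | hadd f g hf hg => rw [pa_mul_add, hf, hg]
  | hpath c i j p =>
    rw [pa_mul_smul, one_def, pa_sum_mul, Finset.sum_eq_single i]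
    · rw [e, path_mul_path, Quiver.Path.nil_comp]
    · intro k _ hk
      exact path_mul_path_of_ne K _ _ hk.symm
    · simp

theorem pa_mul_one [DecidableEq V] [Fintype V] (f : PathAlgebra K V) : f * 1 = f := by
  induction f using induction with
  | h0 => exact pa_zero_mul K _
  | hadd f g hf hg => rw [pa_add_mul, hf, hg]
  | hpath c i j p =>
    rw [pa_smul_mul, one_def, pa_mul_sum, Finset.sum_eq_single j]
    · rw [e, path_mul_path, Quiver.Path.comp_nil]
    · intro k _ hk
      exact path_mul_path_of_ne K _ _ hk
    · simp

instance [DecidableEq V] [Fintype V] : Ring (PathAlgebra K V) :=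
  { (inferInstance : AddCommGroup (PathAlgebra K V)) with
    mul := (· * ·)
    one := 1
    left_distrib := pa_mul_add K
    right_distrib := pa_add_mul K
    zero_mul := pa_zero_mul K
    mul_zero := pa_mul_zero K
    mul_assoc := pa_mul_assoc K
    one_mul := pa_one_mul K
    mul_one := pa_mul_one K }

instance [DecidableEq V] [Fintype V] : Algebra K (PathAlgebra K V) :=
  Algebra.ofModule (pa_smul_mul K) (fun c f g => pa_mul_smul K c f g)

end PathAlgebra

/-! ### The circular quiver with double arrows and the algebra `Λ_s` -/

/-- The arrows of the circular quiver `Γ_s` with double arrows: for every vertex `i` two arrows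
`a_i` and `b_i` from `i` to `i + 1`, where vertices are taken modulo `s`. -/
inductive GammaArrow (s : ℕ) : ZMod s → ZMod s → Type
  | a (i : ZMod s) : GammaArrow s i (i + 1)
  | b (i : ZMod s) : GammaArrow s i (i + 1)

/-- The quiver `Γ_s`, with vertex set `ZMod s`. -/
instance gammaQuiver (s : ℕ) : Quiver (ZMod s) := ⟨GammaArrow s⟩

/-- The path algebra `K Γ_s`. -/
abbrev KGamma (K : Type*) [Field K] (s : ℕ) [NeZero s] : Type _ := PathAlgebra K (ZMod s)

namespace KGamma

variable (K : Type*) [Field K] (s : ℕ) [NeZero s]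

/-- `x = ∑ a_i` in `K Γ_s`. -/
def x : KGamma K s := ∑ i : ZMod s, PathAlgebra.arrow K (j := i + 1) (GammaArrow.a i)

/-- `y = ∑ b_i` in `K Γ_s`. -/
def y : KGamma K s := ∑ i : ZMod s, PathAlgebra.arrow K (j := i + 1) (GammaArrow.b i)

/-- The two-sided ideal `I = ⟨x², xy + yx, y²⟩`. -/
def I : TwoSidedIdeal (KGamma K s) :=
  TwoSidedIdeal.span {x K s ^ 2, x K s * y K s + y K s * x K s, y K s ^ 2}

theorem e_mul_arrow {i k l : ZMod s} (α : k ⟶ l) :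
    PathAlgebra.e K i * PathAlgebra.arrow K α = if i = k then PathAlgebra.arrow K α else 0 := by
  split_ifs with h
  · subst h
    rw [PathAlgebra.e, PathAlgebra.arrow, PathAlgebra.path_mul_path, Quiver.Path.nil_comp]
  · exact PathAlgebra.path_mul_path_of_ne K _ _ (Ne.symm h)

theorem arrow_mul_e {i k l : ZMod s} (α : k ⟶ l) :
    PathAlgebra.arrow K α * PathAlgebra.e K i = if l = i then PathAlgebra.arrow K α else 0 := by
  split_ifs with h
  · subst h
    rw [PathAlgebra.e, PathAlgebra.arrow, PathAlgebra.path_mul_path, Quiver.Path.comp_nil]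
  · exact PathAlgebra.path_mul_path_of_ne K _ _ (Ne.symm h)

theorem e_mul_x (i : ZMod s) :
    PathAlgebra.e K i * x K s = x K s * PathAlgebra.e K (i + 1) := by
  simp [x, Finset.mul_sum, Finset.sum_mul, e_mul_arrow, arrow_mul_e]

theorem e_mul_y (i : ZMod s) :
    PathAlgebra.e K i * y K s = y K s * PathAlgebra.e K (i + 1) := by
  simp [y, Finset.mul_sum, Finset.sum_mul, e_mul_arrow, arrow_mul_e]

end KGamma

/-- The bound quiver algebra `Λ_s = K Γ_s / I`. -/
def Lam (K : Type*) [Field K] (s : ℕ) [NeZero s] : Type _ := (KGamma.I K s).ringCon.Quotient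

namespace Lam

variable (K : Type*) [Field K] (s : ℕ) [NeZero s]

instance : Ring (Lam K s) := inferInstanceAs (Ring (KGamma.I K s).ringCon.Quotient)

instance : Algebra K (Lam K s) := inferInstanceAs (Algebra K (KGamma.I K s).ringCon.Quotient)

/-- The projection `K Γ_s → Λ_s`. -/
def mk : KGamma K s →+* Lam K s := (KGamma.I K s).ringCon.mk'

/-- The class of `x` in `Λ_s`. -/
def x : Lam K s := mk K s (KGamma.x K s)

/-- The class of `y` in `Λ_s`. -/
def y : Lam K s := mk K s (KGamma.y K s)

/-- The class of the trivial path `e_i` in `Λ_s`. -/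
def e (i : ZMod s) : Lam K s := mk K s (PathAlgebra.e K i)

theorem e_mul_e (i : ZMod s) : e K s i * e K s i = e K s i := by
  rw [e, ← map_mul, PathAlgebra.e, PathAlgebra.path_mul_path, Quiver.Path.comp_nil]

theorem e_mul_x (i : ZMod s) : e K s i * x K s = x K s * e K s (i + 1) := by
  rw [e, x, e, ← map_mul, KGamma.e_mul_x, map_mul]

theorem e_mul_y (i : ZMod s) : e K s i * y K s = y K s * e K s (i + 1) := by
  rw [e, y, e, ← map_mul, KGamma.e_mul_y, map_mul]

/-- The enveloping algebra `Λ_s ⊗_K Λ_sᵒᵖ`, over which the left modules are the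
`Λ_s`-`Λ_s`-bimodules on which `K` acts centrally: `a ⊗ op b` acts by `m ↦ a m b`. -/
def Env : Type _ := Lam K s ⊗[K] (Lam K s)ᵐᵒᵖ

instance : Ring (Env K s) := inferInstanceAs (Ring (Lam K s ⊗[K] (Lam K s)ᵐᵒᵖ))

instance : Algebra K (Env K s) := inferInstanceAs (Algebra K (Lam K s ⊗[K] (Lam K s)ᵐᵒᵖ))

/-- The element `a ⊗ op b` of the enveloping algebra. -/
def Env.tmul (a b : Lam K s) : Env K s := a ⊗ₜ[K] MulOpposite.op b

theorem Env.tmul_mul_tmul (a b a' b' : Lam K s) :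
    Env.tmul K s a b * Env.tmul K s a' b' = Env.tmul K s (a * a') (b' * b) :=
  Algebra.TensorProduct.tmul_mul_tmul a a' (MulOpposite.op b) (MulOpposite.op b')

theorem Env.induction {P : Env K s → Prop} (c : Env K s) (h0 : P 0)
    (hadd : ∀ c d, P c → P d → P (c + d)) (htmul : ∀ a b, P (Env.tmul K s a b)) : P c :=
  TensorProduct.induction_on (motive := P) c h0 (fun a b => htmul a b.unop) hadd

/-- `Λ_s` as a bimodule over itself: `(a ⊗ op b) • m = a m b`. -/
instance : Module (Env K s) (Lam K s) :=
  Module.compHom (Lam K s) (AlgHom.mulLeftRight K (Lam K s)).toRingHom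

theorem Env.tmul_smul (a b m : Lam K s) : Env.tmul K s a b • m = a * m * b :=
  AlgHom.mulLeftRight_apply K (Lam K s) a (MulOpposite.op b) m

/-- The left module `Λ_s e_i`. -/
def leftProj (i : ZMod s) : Submodule (Lam K s) (Lam K s) := Submodule.span _ {e K s i}

/-- The right module `e_k Λ_s`. -/
def rightProj (k : ZMod s) : Submodule (Lam K s)ᵐᵒᵖ (Lam K s) := Submodule.span _ {e K s k}

/-- The bimodule `Λ_s e_i ⊗_K e_k Λ_s`. -/
def BiProj (i k : ZMod s) : Type _ := leftProj K s i ⊗[K] rightProj K s k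

instance (i k : ZMod s) : AddCommGroup (BiProj K s i k) :=
  inferInstanceAs (AddCommGroup (leftProj K s i ⊗[K] rightProj K s k))

/-- The underlying `K`-module of the bimodule `Λ_s e_i ⊗_K e_k Λ_s`. -/
instance biProjBase (i k : ZMod s) : Module K (BiProj K s i k) :=
  inferInstanceAs (Module K (leftProj K s i ⊗[K] rightProj K s k))

/-- The bimodule structure, `(a ⊗ op b) • (u ⊗ w) = a u ⊗ w b`. -/
instance biProjModule (i k : ZMod s) : Module (Env K s) (BiProj K s i k) :=
  Module.compHom (leftProj K s i ⊗[K] rightProj K s k)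
    ((Module.endTensorEndAlgHom (R := K) (S := K) (A := K)
        (M := leftProj K s i) (N := rightProj K s k)).comp
      (Algebra.TensorProduct.map (Algebra.lsmul K K (leftProj K s i))
        (Algebra.lsmul K K (rightProj K s k)))).toRingHom

/-- The pure tensor `u ⊗ w`. -/
def BiProj.tmul {i k : ZMod s} (u : leftProj K s i) (w : rightProj K s k) : BiProj K s i k :=
  u ⊗ₜ[K] w

theorem BiProj.smul_tmul {i k : ZMod s} (a b : Lam K s) (u : leftProj K s i)
    (w : rightProj K s k) :
    Env.tmul K s a b • BiProj.tmul K s u w = BiProj.tmul K s (a • u) (MulOpposite.op b • w) := rfl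

theorem BiProj.induction {i k : ZMod s} {P : BiProj K s i k → Prop} (z : BiProj K s i k)
    (h0 : P 0) (hadd : ∀ z w, P z → P w → P (z + w))
    (htmul : ∀ u w, P (BiProj.tmul K s u w)) : P z :=
  TensorProduct.induction_on (motive := P) z h0 htmul hadd

/-- The inclusion `Λ_s e_i ⊗ e_k Λ_s → Λ_s ⊗ Λ_sᵒᵖ` as a `K`-linear map. -/
def inclK (i k : ZMod s) : BiProj K s i k →ₗ[K] Env K s :=
  (TensorProduct.map ((leftProj K s i).subtype.restrictScalars K)
    ((MulOpposite.opLinearEquiv K).toLinearMap ∘ₗ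
      (rightProj K s k).subtype.restrictScalars K) :
    leftProj K s i ⊗[K] rightProj K s k →ₗ[K] Lam K s ⊗[K] (Lam K s)ᵐᵒᵖ)

theorem inclK_tmul {i k : ZMod s} (u : leftProj K s i) (w : rightProj K s k) :
    inclK K s i k (BiProj.tmul K s u w) = Env.tmul K s u w := rfl

/-- The inclusion `Λ_s e_i ⊗ e_k Λ_s → Λ_s ⊗ Λ_sᵒᵖ` as a bimodule homomorphism. -/
def incl (i k : ZMod s) : BiProj K s i k →ₗ[Env K s] Env K s where
  toFun := inclK K s i k
  map_add' := map_add (inclK K s i k)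
  map_smul' c z := by
    rw [RingHom.id_apply]
    induction c using Env.induction with
    | h0 => rw [zero_smul, zero_smul, map_zero]
    | hadd c d hc hd => rw [add_smul, add_smul, map_add, hc, hd]
    | htmul a b =>
      induction z using BiProj.induction with
      | h0 => rw [smul_zero, map_zero, smul_zero]
      | hadd z w hz hw => rw [smul_add, map_add, map_add, smul_add, hz, hw]
      | htmul u w =>
        rw [BiProj.smul_tmul, inclK_tmul, inclK_tmul, smul_eq_mul, Env.tmul_mul_tmul]
        rfl

theorem incl_tmul {i k : ZMod s} (u : leftProj K s i) (w : rightProj K s k) :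
    incl K s i k (BiProj.tmul K s u w) = Env.tmul K s u w := rfl

/-- The generator `e_i ⊗ e_k` of `Λ_s e_i ⊗ e_k Λ_s`. -/
def BiProj.gen (i k : ZMod s) : BiProj K s i k :=
  BiProj.tmul K s ⟨e K s i, Submodule.mem_span_singleton_self _⟩
    ⟨e K s k, Submodule.mem_span_singleton_self _⟩

theorem BiProj.smul_gen (i k : ZMod s) :
    Env.tmul K s (e K s i) (e K s k) • BiProj.gen K s i k =
      BiProj.gen K s i k := by
  rw [BiProj.gen, BiProj.smul_tmul]
  congr 1 <;> exact Subtype.ext (e_mul_e K s _)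

/-- For an element `v` of a bimodule `M`, the bimodule homomorphism
`Λ_s e_i ⊗ e_k Λ_s → M`, `u ⊗ w ↦ u v w`. If `v ∈ e_i M e_k`, it is the bimodule homomorphism
that sends `e_i ⊗ e_k` to `v`. -/
def homOf {M : Type*} [AddCommGroup M] [Module (Env K s) M] (i k : ZMod s) (v : M) :
    BiProj K s i k →ₗ[Env K s] M :=
  LinearMap.toSpanSingleton (Env K s) M v ∘ₗ incl K s i k

theorem homOf_gen {M : Type*} [AddCommGroup M] [Module (Env K s) M] (i k : ZMod s) (v : M) :
    homOf K s i k v (BiProj.gen K s i k) =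
      Env.tmul K s (e K s i) (e K s k) • v := rfl

/-! ### The complex -/

/-- `Qⁿ = ⨁_{i = 0}^{s-1} ⨁_{j = 0}^{n} Λ_s e_i ⊗ e_{i+n} Λ_s`; the index `(i, j)` stands for the
element `g^n_{i,j}`, whose origin is `e_i` and whose terminus is `e_{i+n}`. -/
abbrev Q (n : ℕ) : Type _ :=
  ⨁ p : ZMod s × Fin (n + 1), BiProj K s p.1 (p.1 + (n : ZMod s))

/-- The generator `b^n_{i,j}` of `Qⁿ`. -/
def b (n : ℕ) (i : ZMod s) (j : Fin (n + 1)) : Q K s n :=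
  DirectSum.lof (Env K s) (ZMod s × Fin (n + 1))
    (fun p => BiProj K s p.1 (p.1 + (n : ZMod s))) (i, j) (BiProj.gen K s i (i + (n : ZMod s)))

/-- The left multiplication `a v` in a bimodule. -/
def lmul {M : Type*} [AddCommGroup M] [Module (Env K s) M] (a : Lam K s) (v : M) : M :=
  Env.tmul K s a 1 • v

/-- The right multiplication `v a` in a bimodule. -/
def rmul {M : Type*} [AddCommGroup M] [Module (Env K s) M] (v : M) (a : Lam K s) : M :=
  Env.tmul K s 1 a • v

/-- The image of `b^{n+1}_{i,j}` under `∂^{n+1}`. -/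
def dGen (n : ℕ) (i : ZMod s) (j : Fin (n + 2)) : Q K s n :=
  if h0 : (j : ℕ) = 0 then
    rmul K s (b K s n i ⟨0, by omega⟩) (y K s) +
      (-1 : ℤ) ^ (n + 1) • lmul K s (y K s) (b K s n (i + 1) ⟨0, by omega⟩)
  else if hn : (j : ℕ) = n + 1 then
    rmul K s (b K s n i ⟨n, by omega⟩) (x K s) +
      (-1 : ℤ) ^ (n + 1) • lmul K s (x K s) (b K s n (i + 1) ⟨n, by omega⟩)
  else
    (rmul K s (b K s n i ⟨j - 1, by omega⟩) (x K s) +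
      rmul K s (b K s n i ⟨j, by omega⟩) (y K s)) +
      (-1 : ℤ) ^ (n + 1) •
        (lmul K s (y K s) (b K s n (i + 1) ⟨j, by omega⟩) +
          lmul K s (x K s) (b K s n (i + 1) ⟨j - 1, by omega⟩))

/-- `∂⁰ : Q⁰ → Λ_s`, the multiplication map `u ⊗ w ↦ u w` on every summand. -/
def d0 : Q K s 0 →ₗ[Env K s] Lam K s :=
  DirectSum.toModule (Env K s) (ZMod s × Fin (0 + 1)) (Lam K s)
    fun p => homOf K s p.1 (p.1 + ((0 : ℕ) : ZMod s)) (1 : Lam K s)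

/-- `∂^{n+1} : Q^{n+1} → Qⁿ`, the bimodule homomorphism with `b^{n+1}_{i,j} ↦ dGen n i j`. -/
def d (n : ℕ) : Q K s (n + 1) →ₗ[Env K s] Q K s n :=
  DirectSum.toModule (Env K s) (ZMod s × Fin (n + 1 + 1)) (Q K s n)
    fun p => homOf K s p.1 (p.1 + ((n + 1 : ℕ) : ZMod s)) (dGen K s n p.1 p.2)

theorem d0_tmul (p : ZMod s × Fin (0 + 1)) (u : leftProj K s p.1)
    (w : rightProj K s (p.1 + ((0 : ℕ) : ZMod s))) :
    d0 K s (DirectSum.lof (Env K s) (ZMod s × Fin (0 + 1))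
      (fun p => BiProj K s p.1 (p.1 + ((0 : ℕ) : ZMod s))) p (BiProj.tmul K s u w)) =
      (u : Lam K s) * (w : Lam K s) := by
  rw [d0, DirectSum.toModule_lof, homOf, LinearMap.comp_apply, incl_tmul,
    LinearMap.toSpanSingleton_apply, Env.tmul_smul, mul_one]

theorem smul_b (n : ℕ) (i : ZMod s) (j : Fin (n + 1)) :
    Env.tmul K s (e K s i) (e K s (i + (n : ZMod s))) • b K s n i j = b K s n i j := by
  rw [b, ← map_smul, BiProj.smul_gen]

theorem smul_rmul {M : Type*} [AddCommGroup M] [Module (Env K s) M] {i k : ZMod s} {v : M}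
    (hv : Env.tmul K s (e K s i) (e K s k) • v = v) {z : Lam K s}
    (hz : ∀ i, e K s i * z = z * e K s (i + 1)) :
    Env.tmul K s (e K s i) (e K s (k + 1)) • rmul K s v z = rmul K s v z := by
  rw [← hv, rmul, smul_smul, smul_smul, smul_smul]
  simp only [Env.tmul_mul_tmul, one_mul, mul_one, e_mul_e]
  rw [← hz, ← mul_assoc, e_mul_e]

theorem smul_lmul {M : Type*} [AddCommGroup M] [Module (Env K s) M] {i k : ZMod s} {v : M}
    (hv : Env.tmul K s (e K s (i + 1)) (e K s k) • v = v) {z : Lam K s}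
    (hz : ∀ i, e K s i * z = z * e K s (i + 1)) :
    Env.tmul K s (e K s i) (e K s k) • lmul K s z v = lmul K s z v := by
  rw [← hv, lmul, smul_smul, smul_smul, smul_smul]
  simp only [Env.tmul_mul_tmul, one_mul, mul_one, e_mul_e]
  rw [hz, mul_assoc, e_mul_e]

theorem smul_rmul_b (n : ℕ) (i : ZMod s) (j : Fin (n + 1)) {z : Lam K s}
    (hz : ∀ i, e K s i * z = z * e K s (i + 1)) :
    Env.tmul K s (e K s i) (e K s (i + ((n + 1 : ℕ) : ZMod s))) • rmul K s (b K s n i j) z =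
      rmul K s (b K s n i j) z := by
  rw [Nat.cast_add, Nat.cast_one, ← add_assoc]
  exact smul_rmul K s (smul_b K s n i j) hz

theorem smul_lmul_b (n : ℕ) (i : ZMod s) (j : Fin (n + 1)) {z : Lam K s}
    (hz : ∀ i, e K s i * z = z * e K s (i + 1)) :
    Env.tmul K s (e K s i) (e K s (i + ((n + 1 : ℕ) : ZMod s))) •
      lmul K s z (b K s n (i + 1) j) = lmul K s z (b K s n (i + 1) j) := by
  have h : i + ((n + 1 : ℕ) : ZMod s) = i + 1 + (n : ZMod s) := by push_cast; ring
  rw [h]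
  exact smul_lmul K s (smul_b K s n (i + 1) j) hz

/-- `∂^{n+1}` has the prescribed values on the generators. -/
theorem d_b (n : ℕ) (i : ZMod s) (j : Fin (n + 2)) :
    d K s n (b K s (n + 1) i j) = dGen K s n i j := by
  rw [d, b, DirectSum.toModule_lof, homOf_gen, dGen]
  split_ifs <;>
    simp only [smul_add, smul_comm _ ((-1 : ℤ) ^ (n + 1)), smul_rmul_b K s n i _ (e_mul_x K s),
      smul_rmul_b K s n i _ (e_mul_y K s), smul_lmul_b K s n i _ (e_mul_x K s),
      smul_lmul_b K s n i _ (e_mul_y K s)]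

end Lam

/-! ### Minimal projective resolutions -/

/-- A submodule `L` of `M` is superfluous if `L + X = M` implies `X = M`. -/
def IsSuperfluous {R M : Type*} [Ring R] [AddCommGroup M] [Module R M] (L : Submodule R M) :
    Prop :=
  ∀ X : Submodule R M, L ⊔ X = ⊤ → X = ⊤

/-- A homomorphism `f : P → M` is a projective cover of `M` if `P` is projective and `f` is an
epimorphism with superfluous kernel. -/
structure IsProjectiveCover {R P M : Type*} [Ring R] [AddCommGroup P] [Module R P]
    [AddCommGroup M] [Module R M] (f : P →ₗ[R] M) : Prop where
  projective : Module.Projective R P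
  surjective : Function.Surjective f
  superfluous : IsSuperfluous (LinearMap.ker f)

/-- The sequence `⋯ → P 2 → P 1 → P 0 → M → 0` with maps `d n : P (n + 1) → P n` and
`ε : P 0 → M` is a minimal projective resolution of `M`: it is exact, `ε` is a projective cover
of `M`, and each `d n` is a projective cover of its image. -/
structure IsMinimalProjectiveResolution {R M : Type*} {P : ℕ → Type*} [Ring R]
    [AddCommGroup M] [Module R M] [∀ n, AddCommGroup (P n)] [∀ n, Module R (P n)]
    (ε : P 0 →ₗ[R] M) (d : ∀ n, P (n + 1) →ₗ[R] P n) : Prop where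
  exact_zero : Function.Exact (d 0) ε
  exact_succ : ∀ n, Function.Exact (d (n + 1)) (d n)
  cover_zero : IsProjectiveCover ε
  cover_succ : ∀ n, IsProjectiveCover (d n).rangeRestrict

end

/-! Write `[n, a]` for the element `1 ⊗ a + (-1)^{n+1} a ⊗ 1` of the enveloping algebra, which acts
on bimodules as a graded commutator with `a`. For `a, b ∈ {x, y}` the products `[n + 1, a] * [n, b]`
inherit the relations `x² = xy + yx = y² = 0`, so the free bimodules of rank `n + 1` carry
differentials of Koszul type, and `Q` is a direct summand of this complex.

The skew derivations `D` of `Λ_s` with `D x = 1, D y = 0` and with `D x = 0, D y = 1`, applied to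
the right tensor factor, act as contracting homotopies: they solve `a * [n + 1, x] = c` whenever
`c * [n, x] = 0`, and `a * [n + 1, x] + b * [n + 1, y] = c` whenever `c * [n, y]` is a multiple of
`[n, x]`. Hence the free complex is exact in positive degrees, and so is `Q`. In degree `0` the
kernel of the multiplication map is generated by the elements `1 ⊗ a - a ⊗ 1`, and it suffices to
take `a = x` and `a = y`.

For minimality, `x Λ_s x = 0 = y Λ_s y` puts every `[n, x]` and `[n, y]` into the Jacobson radical
of the enveloping algebra, and by Nakayama's lemma the radical of a finitely generated module is
superfluous. -/

noncomputable section

section Superfluous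

variable {R : Type*} [Ring R]

theorem IsSuperfluous.of_le_jacobson {M : Type*} [AddCommGroup M] [Module R M] [Module.Finite R M]
    {L : Submodule R M} (hL : L ≤ Module.jacobson R M) : IsSuperfluous L := by
  intro X hX
  by_contra hne
  obtain ⟨m, hm, hXm⟩ := (eq_top_or_exists_le_coatom X).resolve_left hne
  exact hm.1 (top_le_iff.1 (hX ▸ sup_le (hL.trans (sInf_le hm)) hXm))

theorem mem_jacobson_of_mul_mul_eq_zero {z : R} (h : ∀ c, z * c * z = 0) :
    z ∈ Ring.jacobson R := by
  rw [← Ideal.jacobson_bot, Ideal.mem_jacobson_iff]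
  intro c
  refine ⟨1 - c * z, ?_⟩
  have hcz : c * z * (c * z) = 0 := by rw [mul_assoc, ← mul_assoc z, h, mul_zero]
  rw [Ideal.mem_bot, mul_assoc, sub_mul, one_mul, hcz]
  abel

end Superfluous

section Koszul

variable {A : Type*} [Ring A]

/-- The left `A`-linear map `A^{m+1} → A^m`, `(f_j) ↦ (f_{j+1} X + f_j Y)`, which is the `m`-th
differential of the Koszul complex on two anticommuting elements `X` and `Y`. -/
def koszulMap (X Y : A) (m : ℕ) : (Fin (m + 1) → A) →ₗ[A] (Fin m → A) :=
  LinearMap.pi fun j =>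
    (LinearMap.proj j.succ).smulRight X + (LinearMap.proj j.castSucc).smulRight Y

@[simp]
theorem koszulMap_apply (X Y : A) {m : ℕ} (f : Fin (m + 1) → A) (j : Fin m) :
    koszulMap X Y m f j = f j.succ * X + f j.castSucc * Y :=
  rfl

variable {X Y X' Y' : A}

theorem koszulMap_koszulMap (hX : X' * X = 0) (hXY : X' * Y + Y' * X = 0) (hY : Y' * Y = 0)
    {m : ℕ} (f : Fin (m + 2) → A) : koszulMap X Y m (koszulMap X' Y' (m + 1) f) = 0 := by
  ext j
  simp only [koszulMap_apply, add_mul, mul_assoc, hX, hY, mul_zero, zero_add,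
    add_zero, Pi.zero_apply]
  rw [← Fin.succ_castSucc, ← mul_add, add_comm (Y' * X), hXY, mul_zero]

theorem exists_koszulMap_eq (hXY : X' * Y + Y' * X = 0) (hY : Y' * Y = 0)
    (hsolve : ∀ c, c * X = 0 → ∃ a, a * X' = c) {m : ℕ} {f : Fin (m + 1) → A}
    (hf : koszulMap X Y m f = 0) (h0 : ∃ a b, f 0 = a * X' + b * Y') :
    ∃ g, koszulMap X' Y' (m + 1) g = f := by
  suffices ∃ g : Fin (m + 2) → A, ∀ j, g j.succ * X' + g j.castSucc * Y' = f j from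
    this.imp fun g hg => funext hg
  induction m with
  | zero =>
    obtain ⟨a, b, hab⟩ := h0
    refine ⟨![b, a], fun j => ?_⟩
    rw [Fin.fin_one_eq_zero j, hab]
    rfl
  | succ m ih =>
    obtain ⟨g, hg⟩ := ih (f := Fin.init f) (funext fun j => congrFun hf j.castSucc) h0
    have hlast : (f (Fin.last _) - g (Fin.last _) * Y') * X = 0 := by
      have hfm := congrFun hf (Fin.last m)
      have hgm : g (Fin.last _) * X' + g _ * Y' = f (Fin.last m).castSucc := hg (Fin.last m)
      rw [koszulMap_apply, ← hgm, Fin.succ_last, Pi.zero_apply, add_mul, mul_assoc _ Y' Y, hY,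
        mul_zero, add_zero, mul_assoc, eq_neg_of_add_eq_zero_left hXY, mul_neg,
        ← sub_eq_add_neg] at hfm
      rwa [sub_mul, mul_assoc]
    obtain ⟨a, ha⟩ := hsolve _ hlast
    refine ⟨Fin.snoc g a, Fin.lastCases ?_ fun j => ?_⟩
    · rw [Fin.succ_last, Fin.snoc_last, Fin.snoc_castSucc, ha, sub_add_cancel]
    · rw [Fin.succ_castSucc, Fin.snoc_castSucc, Fin.snoc_castSucc]
      exact hg j

/-- Solving `g_{j+1} X' + g_j Y' = f_j` for `g` one index after the other, only the first equation
involves two unknowns. -/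
theorem exact_koszulMap (hX : X' * X = 0) (hXY : X' * Y + Y' * X = 0) (hY : Y' * Y = 0)
    (hsolve : ∀ c, c * X = 0 → ∃ a, a * X' = c)
    (hsolve₂ : ∀ c c', c * Y = c' * X → ∃ a b, c = a * X' + b * Y') (m : ℕ) :
    Function.Exact (koszulMap X' Y' (m + 2)) (koszulMap X Y (m + 1)) := by
  intro f
  refine ⟨fun hf => exists_koszulMap_eq hXY hY hsolve hf ?_, ?_⟩
  · refine hsolve₂ (f 0) (-f 1) ?_
    have h0 : f 1 * X + f 0 * Y = 0 := congrFun hf 0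
    rw [neg_mul, eq_neg_of_add_eq_zero_right h0]
  · rintro ⟨g, rfl⟩
    exact koszulMap_koszulMap hX hXY hY g

end Koszul

namespace Lam

section PathProd

variable {s : ℕ} {A : Type*} [Monoid A] (X Y : A)

/-- The letter of an arrow of `Γ_s`: `X` for the arrows `a_i` and `Y` for the arrows `b_i`. -/
def letter {i j : ZMod s} : GammaArrow s i j → A
  | .a _ => X
  | .b _ => Y

/-- The product of the letters of the arrows of a path in `Γ_s`. -/
def pathProd {i : ZMod s} : ∀ {j : ZMod s}, Quiver.Path i j → A
  | _, .nil => 1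
  | _, .cons p α => pathProd p * letter X Y α

theorem pathProd_comp {i j k : ZMod s} (p : Quiver.Path i j) (q : Quiver.Path j k) :
    pathProd X Y (p.comp q) = pathProd X Y p * pathProd X Y q := by
  induction q with
  | nil => exact (mul_one _).symm
  | cons q α ih => rw [Quiver.Path.comp_cons, pathProd, pathProd, ih, mul_assoc]

end PathProd

section Presentation

variable {s : ℕ} [NeZero s] {A : Type*} [Ring A]

/-- The defining relations of `Λ_s`, for elements `E i`, `X`, `Y` of a ring in the roles of `e_i`,
`x`, `y`. -/
structure Relations (E : ZMod s → A) (X Y : A) : Prop extends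
    CompleteOrthogonalIdempotents E where
  mul_x : ∀ i, E i * X = X * E (i + 1)
  mul_y : ∀ i, E i * Y = Y * E (i + 1)
  x_mul_x : X * X = 0
  x_mul_y : X * Y + Y * X = 0
  y_mul_y : Y * Y = 0

variable {E : ZMod s → A} {X Y : A}

namespace Relations

theorem mul_letter (r : Relations E X Y) {i j : ZMod s} (α : GammaArrow s i j) :
    E i * letter X Y α = letter X Y α * E j := by
  cases α with
  | a => exact r.mul_x i
  | b => exact r.mul_y i

theorem mul_pathProd (r : Relations E X Y) {i j : ZMod s} (p : Quiver.Path i j) :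
    E i * pathProd X Y p = pathProd X Y p * E j := by
  induction p with
  | nil => rw [pathProd, mul_one, one_mul]
  | cons p α ih => rw [pathProd, ← mul_assoc, ih, mul_assoc, r.mul_letter, mul_assoc]

variable (K : Type*) [Field K] [Algebra K A]

/-- The linear map `K Γ_s → A` underlying `Lam.Relations.evalHom`. -/
def evalLin (E : ZMod s → A) (X Y : A) : KGamma K s →ₗ[K] A :=
  PathAlgebra.lift K fun p => E p.1 * pathProd X Y p.2.2

theorem evalLin_path {i j : ZMod s} (p : Quiver.Path i j) :
    evalLin K E X Y (PathAlgebra.path K p) = E i * pathProd X Y p :=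
  PathAlgebra.lift_path K _ p

theorem evalLin_path_mul_path (r : Relations E X Y) {i j k l : ZMod s} (p : Quiver.Path i j)
    (q : Quiver.Path k l) :
    evalLin K E X Y (PathAlgebra.path K p * PathAlgebra.path K q) =
      evalLin K E X Y (PathAlgebra.path K p) * evalLin K E X Y (PathAlgebra.path K q) := by
  rw [evalLin_path, evalLin_path]
  obtain rfl | hkj := eq_or_ne k j
  · rw [PathAlgebra.path_mul_path, evalLin_path, pathProd_comp, ← mul_assoc (_ * _),
      mul_assoc (E i), ← r.mul_pathProd p, ← mul_assoc (E i) (E i), r.idem, mul_assoc (E i)]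
  · rw [PathAlgebra.path_mul_path_of_ne K p q hkj, map_zero, r.mul_pathProd p, mul_assoc,
      ← mul_assoc (E j), r.ortho hkj.symm, zero_mul, mul_zero]

theorem evalLin_mul (r : Relations E X Y) (f g : KGamma K s) :
    evalLin K E X Y (f * g) = evalLin K E X Y f * evalLin K E X Y g := by
  induction f using PathAlgebra.induction with
  | h0 => simp only [zero_mul, map_zero]
  | hadd f f' hf hf' => rw [add_mul, map_add, map_add, add_mul, hf, hf']
  | hpath c i j p =>
    induction g using PathAlgebra.induction with
    | h0 => simp only [mul_zero, map_zero]
    | hadd g g' hg hg' => rw [mul_add, map_add, map_add, mul_add, hg, hg']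
    | hpath c' k l q =>
      rw [smul_mul_smul_comm, map_smul, map_smul, map_smul, smul_mul_smul_comm,
        r.evalLin_path_mul_path K]

theorem evalLin_e (i : ZMod s) : evalLin K E X Y (PathAlgebra.e K i) = E i :=
  (evalLin_path K _).trans (mul_one _)

/-- The homomorphism `K Γ_s → A` with `e_i ↦ E i`, `x ↦ X` and `y ↦ Y`. -/
def evalHom (r : Relations E X Y) : KGamma K s →ₐ[K] A :=
  AlgHom.ofLinearMap (evalLin K E X Y)
    (by simp only [PathAlgebra.one_def, map_sum, evalLin_e, r.complete])
    (r.evalLin_mul K)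

theorem evalHom_x (r : Relations E X Y) : r.evalHom K (KGamma.x K s) = X := by
  have harrow (i : ZMod s) :
      r.evalHom K (PathAlgebra.arrow K (j := i + 1) (GammaArrow.a i)) = E i * X :=
    (evalLin_path K _).trans (congrArg _ (one_mul _))
  simp only [KGamma.x, map_sum, harrow, ← Finset.sum_mul, r.complete, one_mul]

theorem evalHom_y (r : Relations E X Y) : r.evalHom K (KGamma.y K s) = Y := by
  have harrow (i : ZMod s) :
      r.evalHom K (PathAlgebra.arrow K (j := i + 1) (GammaArrow.b i)) = E i * Y :=
    (evalLin_path K _).trans (congrArg _ (one_mul _))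
  simp only [KGamma.y, map_sum, harrow, ← Finset.sum_mul, r.complete, one_mul]

theorem I_le_ker_evalHom (r : Relations E X Y) :
    KGamma.I K s ≤ TwoSidedIdeal.ker (r.evalHom K) := by
  rw [KGamma.I, TwoSidedIdeal.span_le]
  rintro f (rfl | rfl | rfl) <;>
    simp only [SetLike.mem_coe, TwoSidedIdeal.mem_ker, pow_two, map_add, map_mul, evalHom_x,
      evalHom_y, r.x_mul_x, r.x_mul_y, r.y_mul_y]

/-- The homomorphism `Λ_s → A` with `e_i ↦ E i`, `x ↦ X` and `y ↦ Y`. -/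
def lift (r : Relations E X Y) : Lam K s →ₐ[K] A :=
  RingCon.liftₐ (KGamma.I K s).ringCon (r.evalHom K) fun f g hfg => by
    have hker := r.I_le_ker_evalHom K ((TwoSidedIdeal.rel_iff _ f g).1 hfg)
    rwa [TwoSidedIdeal.mem_ker, map_sub, sub_eq_zero] at hker

@[simp]
theorem lift_e (r : Relations E X Y) (i : ZMod s) : r.lift K (e K s i) = E i :=
  evalLin_e K i

@[simp]
theorem lift_x (r : Relations E X Y) : r.lift K (x K s) = X :=
  r.evalHom_x K

@[simp]
theorem lift_y (r : Relations E X Y) : r.lift K (y K s) = Y :=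
  r.evalHom_y K

end Relations

end Presentation

variable (K : Type*) [Field K] (s : ℕ) [NeZero s]

theorem mk_eq_zero {f : KGamma K s} (hf : f ∈ KGamma.I K s) : mk K s f = 0 := by
  rw [← TwoSidedIdeal.ker_ringCon_mk' (KGamma.I K s)] at hf
  exact (TwoSidedIdeal.mem_ker _).1 hf

theorem relations : Relations (e K s) (x K s) (y K s) where
  idem := e_mul_e K s
  ortho i k hik := by
    change e K s i * e K s k = 0
    rw [e, e, ← map_mul, PathAlgebra.e, PathAlgebra.e,
      PathAlgebra.path_mul_path_of_ne K _ _ hik.symm, map_zero]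
  complete := by simp only [e, ← map_sum, ← PathAlgebra.one_def, map_one]
  mul_x := e_mul_x K s
  mul_y := e_mul_y K s
  x_mul_x := by
    rw [x, ← map_mul, ← pow_two]
    exact mk_eq_zero K s (TwoSidedIdeal.subset_span (by simp))
  x_mul_y := by
    rw [x, y, ← map_mul, ← map_mul, ← map_add]
    exact mk_eq_zero K s (TwoSidedIdeal.subset_span (by simp))
  y_mul_y := by
    rw [y, ← map_mul, ← pow_two]
    exact mk_eq_zero K s (TwoSidedIdeal.subset_span (by simp))

theorem mk_arrow_a (i : ZMod s) :
    mk K s (PathAlgebra.arrow K (j := i + 1) (GammaArrow.a i)) = e K s i * x K s := by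
  rw [e, x, ← map_mul, KGamma.x, Finset.mul_sum]
  simp [KGamma.e_mul_arrow]

theorem mk_arrow_b (i : ZMod s) :
    mk K s (PathAlgebra.arrow K (j := i + 1) (GammaArrow.b i)) = e K s i * y K s := by
  rw [e, y, ← map_mul, KGamma.y, Finset.mul_sum]
  simp [KGamma.e_mul_arrow]

variable {K s} in
@[elab_as_elim]
theorem induction {P : Lam K s → Prop} (a : Lam K s) (he : ∀ i, P (e K s i)) (hx : P (x K s))
    (hy : P (y K s)) (hadd : ∀ a b, P a → P b → P (a + b))
    (hsmul : ∀ (c : K) (a), P a → P (c • a)) (hmul : ∀ a b, P a → P b → P (a * b)) : P a := by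
  have harrow {k l : ZMod s} (α : k ⟶ l) : P (mk K s (PathAlgebra.arrow K α)) :=
    match α with
    | .a _ => mk_arrow_a K s k ▸ hmul _ _ (he k) hx
    | .b _ => mk_arrow_b K s k ▸ hmul _ _ (he k) hy
  have hpath {i j : ZMod s} (p : Quiver.Path i j) : P (mk K s (PathAlgebra.path K p)) := by
    induction p with
    | nil => exact he i
    | cons p α ih =>
      have hcons : PathAlgebra.path K (p.cons α) = PathAlgebra.path K p * PathAlgebra.arrow K α :=
        (PathAlgebra.path_mul_path K p α.toPath).symm
      rw [hcons, map_mul]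
      exact hmul _ _ ih (harrow α)
  obtain ⟨f, rfl⟩ := RingCon.mk'_surjective _ a
  change P (mk K s f)
  induction f using PathAlgebra.induction with
  | h0 => simpa only [zero_smul, map_zero] using hsmul 0 _ (he 0)
  | hadd f g hf hg => exact map_add (mk K s) f g ▸ hadd _ _ hf hg
  | hpath c i j p => exact hsmul c _ (hpath p)

section SkewDerivation

theorem Relations.upperTriangular {s : ℕ} [NeZero s] {K A : Type*} [Field K] [Ring A] [Algebra K A]
    {E : ZMod s → A} {X Y : A} (r : Relations E X Y) (α β : K) :
    Relations (fun i => !![E (i + 1), 0; 0, E i]) !![-X, α • 1; 0, X] !![-Y, β • 1; 0, Y] where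
  idem i := by simp [IsIdempotentElem, r.mul_eq]
  ortho i k hik := by
    have hik' : i + 1 ≠ k + 1 := fun h => hik (add_right_cancel h)
    ext u v
    fin_cases u <;> fin_cases v <;> simp [r.mul_eq, hik, hik']
  complete := by
    have hshift : ∑ i, E (i + 1) = 1 := (Equiv.sum_comp (Equiv.addRight 1) E).trans r.complete
    ext u v
    fin_cases u <;> fin_cases v <;> simp [Matrix.sum_apply, r.complete, hshift]
  mul_x i := by simp [r.mul_x]
  mul_y i := by simp [r.mul_y]
  x_mul_x := by
    ext u v
    fin_cases u <;> fin_cases v <;> simp [r.x_mul_x]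
  x_mul_y := by
    have hyx : Y * X = -(X * Y) := eq_neg_of_add_eq_zero_right r.x_mul_y
    ext u v
    fin_cases u <;> fin_cases v <;> simp [hyx]
  y_mul_y := by
    ext u v
    fin_cases u <;> fin_cases v <;> simp [r.y_mul_y]

variable {K}

/-- The skew derivation `D` of `Λ_s` with `D e_i = 0`, `D x = α` and `D y = β`, where
`D (a b) = D a b + σ a D b` for the automorphism `σ` with `e_i ↦ e_{i+1}`, `x ↦ -x`, `y ↦ -y`.
It is the upper right entry of the homomorphism to matrices `!![σ a, D a; 0, a]`. -/
def skewDer (α β : K) : Lam K s →ₗ[K] Lam K s :=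
  Matrix.entryLinearMap K _ 0 1 ∘ₗ (((relations K s).upperTriangular α β).lift K).toLinearMap

theorem upperTriangular_lift_one (α β : K) (a : Lam K s) :
    ((relations K s).upperTriangular α β).lift K a 1 0 = 0 ∧
      ((relations K s).upperTriangular α β).lift K a 1 1 = a := by
  induction a using Lam.induction with
  | he i => simp
  | hx => simp
  | hy => simp
  | hadd a b ha hb => simp [ha, hb]
  | hsmul c a ha => simp [ha]
  | hmul a b ha hb => simp [Matrix.mul_apply, Fin.sum_univ_two, ha, hb]

theorem skewDer_x_mul (α β : K) (a : Lam K s) :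
    skewDer s α β (x K s * a) = α • a - x K s * skewDer s α β a := by
  have ha := (upperTriangular_lift_one s α β a).2
  simp only [skewDer, LinearMap.comp_apply, AlgHom.toLinearMap_apply, Matrix.entryLinearMap_apply,
    map_mul, Matrix.mul_apply, Fin.sum_univ_two, Relations.lift_x, ha]
  simp [neg_add_eq_sub]

theorem skewDer_y_mul (α β : K) (a : Lam K s) :
    skewDer s α β (y K s * a) = β • a - y K s * skewDer s α β a := by
  have ha := (upperTriangular_lift_one s α β a).2
  simp only [skewDer, LinearMap.comp_apply, AlgHom.toLinearMap_apply, Matrix.entryLinearMap_apply,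
    map_mul, Matrix.mul_apply, Fin.sum_univ_two, Relations.lift_y, ha]
  simp [neg_add_eq_sub]

end SkewDerivation

section Normal

variable {K s} {z : Lam K s}

theorem exists_mul_eq_mul (he : ∀ i, e K s i * z = z * e K s (i + 1))
    (hx : z * x K s = -(x K s * z)) (hy : z * y K s = -(y K s * z)) (a : Lam K s) :
    ∃ a', z * a = a' * z := by
  induction a using Lam.induction with
  | he i => exact ⟨e K s (i - 1), by rw [he, sub_add_cancel]⟩
  | hx => exact ⟨-x K s, by rw [hx, neg_mul]⟩
  | hy => exact ⟨-y K s, by rw [hy, neg_mul]⟩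
  | hadd a b ha hb =>
    obtain ⟨⟨a', ha⟩, b', hb⟩ := ha, hb
    exact ⟨a' + b', by rw [mul_add, ha, hb, add_mul]⟩
  | hsmul c a ha =>
    obtain ⟨a', ha⟩ := ha
    exact ⟨c • a', by rw [mul_smul_comm, ha, smul_mul_assoc]⟩
  | hmul a b ha hb =>
    obtain ⟨⟨a', ha⟩, b', hb⟩ := ha, hb
    exact ⟨a' * b', by rw [← mul_assoc, ha, mul_assoc, hb, mul_assoc]⟩

theorem mul_mul_self_eq_zero (he : ∀ i, e K s i * z = z * e K s (i + 1))
    (hx : z * x K s = -(x K s * z)) (hy : z * y K s = -(y K s * z)) (hz : z * z = 0)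
    (a : Lam K s) : z * a * z = 0 := by
  obtain ⟨a', ha⟩ := exists_mul_eq_mul he hx hy a
  rw [ha, mul_assoc, hz, mul_zero]

variable (K s)

theorem x_mul_mul_x (a : Lam K s) : x K s * a * x K s = 0 :=
  have r := relations K s
  mul_mul_self_eq_zero r.mul_x (by rw [r.x_mul_x, neg_zero])
    (eq_neg_of_add_eq_zero_left r.x_mul_y) r.x_mul_x a

theorem y_mul_mul_y (a : Lam K s) : y K s * a * y K s = 0 :=
  have r := relations K s
  mul_mul_self_eq_zero r.mul_y (eq_neg_of_add_eq_zero_right r.x_mul_y)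
    (by rw [r.y_mul_y, neg_zero]) r.y_mul_y a

end Normal

section Env

variable {K s}

theorem Env.tmul_add (a b c : Lam K s) :
    Env.tmul K s a (b + c) = Env.tmul K s a b + Env.tmul K s a c :=
  TensorProduct.tmul_add _ _ _

theorem Env.add_tmul (a b c : Lam K s) :
    Env.tmul K s (a + b) c = Env.tmul K s a c + Env.tmul K s b c :=
  TensorProduct.add_tmul _ _ _

theorem Env.tmul_zero (a : Lam K s) : Env.tmul K s a 0 = 0 :=
  TensorProduct.tmul_zero _ _

theorem Env.zero_tmul (a : Lam K s) : Env.tmul K s 0 a = 0 :=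
  TensorProduct.zero_tmul _ _

theorem Env.tmul_sub (a b c : Lam K s) :
    Env.tmul K s a (b - c) = Env.tmul K s a b - Env.tmul K s a c :=
  TensorProduct.tmul_sub _ _ _

theorem Env.tmul_smul_right (c : K) (a b : Lam K s) :
    Env.tmul K s a (c • b) = c • Env.tmul K s a b :=
  TensorProduct.tmul_smul c a (MulOpposite.op b)

theorem Env.tmul_smul_left (c : K) (a b : Lam K s) :
    Env.tmul K s (c • a) b = c • Env.tmul K s a b :=
  TensorProduct.smul_tmul' c a (MulOpposite.op b)

/-- The `K`-linear map `a ⊗ w ↦ a ⊗ T w`. -/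
def mapRight (T : Lam K s →ₗ[K] Lam K s) : Env K s →ₗ[K] Env K s :=
  (LinearMap.lTensor (Lam K s) ((MulOpposite.opLinearEquiv K).conj T) :
    Lam K s ⊗[K] (Lam K s)ᵐᵒᵖ →ₗ[K] Lam K s ⊗[K] (Lam K s)ᵐᵒᵖ)

theorem mapRight_tmul (T : Lam K s →ₗ[K] Lam K s) (a w : Lam K s) :
    mapRight T (Env.tmul K s a w) = Env.tmul K s a (T w) :=
  rfl

/-- The element of the enveloping algebra that acts on bimodules by the graded commutator
`m ↦ m a + (-1)^{n+1} a m`. -/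
def gradedComm (n : ℕ) (a : Lam K s) : Env K s :=
  Env.tmul K s 1 a + (-1 : ℤ) ^ (n + 1) • Env.tmul K s a 1

theorem gradedComm_smul {M : Type*} [AddCommGroup M] [Module (Env K s) M] (n : ℕ) (a : Lam K s)
    (m : M) : gradedComm n a • m = rmul K s m a + (-1 : ℤ) ^ (n + 1) • lmul K s a m := by
  rw [gradedComm, add_smul, smul_assoc, rmul, lmul]

theorem gradedComm_succ_mul_gradedComm (n : ℕ) (a b : Lam K s) :
    gradedComm (n + 1) a * gradedComm n b = Env.tmul K s 1 (b * a) - Env.tmul K s (a * b) 1 +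
      (-1 : ℤ) ^ (n + 1) • (Env.tmul K s b a - Env.tmul K s a b) := by
  have hsq : (-1 : ℤ) ^ (n + 1) * (-1) ^ (n + 1) = 1 := by
    rw [← mul_pow, neg_one_mul, neg_neg, one_pow]
  simp only [gradedComm, pow_succ _ (n + 1), mul_neg_one, neg_smul, add_mul, mul_add, neg_mul,
    smul_mul_assoc, mul_smul_comm, smul_smul, hsq, Env.tmul_mul_tmul, mul_one, one_mul, smul_sub,
    smul_add, smul_neg, one_smul]
  abel

theorem gradedComm_succ_mul_gradedComm_self (n : ℕ) {z : Lam K s} (hz : z * z = 0) :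
    gradedComm (n + 1) z * gradedComm n z = 0 := by
  rw [gradedComm_succ_mul_gradedComm, hz, Env.tmul_zero, Env.zero_tmul, sub_self, sub_self,
    smul_zero, add_zero]

theorem gradedComm_anticomm (n : ℕ) {a b : Lam K s} (hab : a * b + b * a = 0) :
    gradedComm (n + 1) a * gradedComm n b + gradedComm (n + 1) b * gradedComm n a = 0 := by
  calc
    _ = Env.tmul K s 1 (a * b + b * a) - Env.tmul K s (a * b + b * a) 1 := by
      simp only [gradedComm_succ_mul_gradedComm, Env.tmul_add, Env.add_tmul, smul_sub]
      abel
    _ = 0 := by rw [hab, Env.tmul_zero, Env.zero_tmul, sub_self]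

theorem mapRight_mul_gradedComm {D : Lam K s →ₗ[K] Lam K s} {a : Lam K s} {r : K}
    (hD : ∀ w, D (a * w) = r • w - a * D w) (n : ℕ) (c : Env K s) :
    mapRight D (c * gradedComm n a) = r • c - mapRight D c * gradedComm (n + 1) a := by
  induction c using Env.induction with
  | h0 => simp only [zero_mul, map_zero, smul_zero, sub_zero]
  | hadd c c' hc hc' => rw [add_mul, map_add, hc, hc', map_add, add_mul, smul_add]; abel
  | htmul u w =>
    simp only [gradedComm, pow_succ _ (n + 1), neg_smul, mul_add, mul_neg,
      mul_smul_comm, Env.tmul_mul_tmul, map_add, map_zsmul, mapRight_tmul, hD, Env.tmul_sub,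
      Env.tmul_smul_right, mul_one, one_mul]
    abel

theorem exists_mul_gradedComm_x (n : ℕ) (c : Env K s) (hc : c * gradedComm n (x K s) = 0) :
    ∃ a, a * gradedComm (n + 1) (x K s) = c := by
  have h := mapRight_mul_gradedComm (skewDer_x_mul s 1 0) n c
  rw [hc, map_zero, one_smul] at h
  exact ⟨_, (sub_eq_zero.1 h.symm).symm⟩

theorem exists_mul_gradedComm_x_add_mul_gradedComm_y (n : ℕ) (c c' : Env K s)
    (hc : c * gradedComm n (y K s) = c' * gradedComm n (x K s)) :
    ∃ a b, c = a * gradedComm (n + 1) (x K s) + b * gradedComm (n + 1) (y K s) := by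
  have hy := mapRight_mul_gradedComm (skewDer_y_mul s 0 1) n c
  have hx := mapRight_mul_gradedComm (skewDer_x_mul s 0 1) n c'
  rw [hc, hx, one_smul, zero_smul, zero_sub] at hy
  exact ⟨_, _, by rw [neg_mul, hy]; abel⟩

theorem exact_koszulMap_gradedComm (n : ℕ) :
    Function.Exact
      (koszulMap (gradedComm (n + 1) (x K s)) (gradedComm (n + 1) (y K s)) (n + 2))
      (koszulMap (gradedComm n (x K s)) (gradedComm n (y K s)) (n + 1)) :=
  have r := relations K s
  exact_koszulMap (gradedComm_succ_mul_gradedComm_self n r.x_mul_x)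
    (gradedComm_anticomm n r.x_mul_y) (gradedComm_succ_mul_gradedComm_self n r.y_mul_y)
    (exists_mul_gradedComm_x n) (exists_mul_gradedComm_x_add_mul_gradedComm_y n) n

theorem gradedComm_mem_jacobson (n : ℕ) {z : Lam K s} (hz : ∀ a, z * a * z = 0) :
    gradedComm n z ∈ Ring.jacobson (Env K s) := by
  refine add_mem (mem_jacobson_of_mul_mul_eq_zero fun c => ?_)
    (zsmul_mem (mem_jacobson_of_mul_mul_eq_zero fun c => ?_) _) <;>
  induction c using Env.induction with
  | h0 => rw [mul_zero, zero_mul]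
  | hadd c c' hc hc' => rw [mul_add, add_mul, hc, hc', add_zero]
  | htmul a b => simp only [Env.tmul_mul_tmul, ← mul_assoc, hz, Env.tmul_zero, Env.zero_tmul]

end Env

section Free

theorem BiProj.exists_smul_gen {i k : ZMod s} (z : BiProj K s i k) :
    ∃ c : Env K s, c • BiProj.gen K s i k = z := by
  induction z using BiProj.induction with
  | h0 => exact ⟨0, zero_smul _ _⟩
  | hadd z w hz hw =>
    obtain ⟨⟨c, rfl⟩, d, rfl⟩ := hz, hw
    exact ⟨c + d, add_smul _ _ _⟩
  | htmul u w =>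
    obtain ⟨a, ha⟩ := Submodule.mem_span_singleton.1 u.2
    obtain ⟨c, hc⟩ := Submodule.mem_span_singleton.1 w.2
    refine ⟨Env.tmul K s a c.unop, ?_⟩
    rw [BiProj.gen, BiProj.smul_tmul]
    exact congrArg₂ _ (Subtype.ext ha) (Subtype.ext hc)

variable {K s} in
theorem hom_ext_b {M : Type*} [AddCommGroup M] [Module (Env K s) M] {n : ℕ}
    {f g : Q K s n →ₗ[Env K s] M} (h : ∀ i j, f (b K s n i j) = g (b K s n i j)) : f = g := by
  refine DirectSum.linearMap_ext _ fun p => LinearMap.ext fun z => ?_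
  obtain ⟨c, rfl⟩ := BiProj.exists_smul_gen K s z
  rw [map_smul, map_smul]
  exact congrArg (c • ·) (h p.1 p.2)

/-- The sum of the generators `b^n_{i,j}` over all vertices `i`. -/
def bSum (n : ℕ) (j : Fin (n + 1)) : Q K s n := ∑ i, b K s n i j

theorem lmul_e_b (n : ℕ) (k i : ZMod s) (j : Fin (n + 1)) :
    lmul K s (e K s k) (b K s n i j) = if k = i then b K s n i j else 0 := by
  rw [lmul, ← smul_b, smul_smul, Env.tmul_mul_tmul, mul_one, (relations K s).mul_eq]
  split_ifs with hki
  · rw [hki]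
  · rw [Env.zero_tmul, zero_smul]

theorem rmul_b_e (n : ℕ) (k i : ZMod s) (j : Fin (n + 1)) :
    rmul K s (b K s n i j) (e K s (k + n)) = if k = i then b K s n i j else 0 := by
  rw [rmul, ← smul_b, smul_smul, Env.tmul_mul_tmul, one_mul, (relations K s).mul_eq]
  simp only [add_left_inj, eq_comm (a := i)]
  split_ifs with hki
  · rfl
  · rw [Env.tmul_zero, zero_smul]

theorem lmul_e_bSum (n : ℕ) (i : ZMod s) (j : Fin (n + 1)) :
    lmul K s (e K s i) (bSum K s n j) = b K s n i j := by
  have hsum : lmul K s (e K s i) (bSum K s n j) = ∑ k, lmul K s (e K s i) (b K s n k j) :=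
    Finset.smul_sum
  simp only [hsum, lmul_e_b, Finset.sum_ite_eq, Finset.mem_univ, if_true]

theorem rmul_bSum_e (n : ℕ) (i : ZMod s) (j : Fin (n + 1)) :
    rmul K s (bSum K s n j) (e K s (i + n)) = b K s n i j := by
  have hsum : rmul K s (bSum K s n j) (e K s (i + n)) =
      ∑ k, rmul K s (b K s n k j) (e K s (i + n)) := Finset.smul_sum
  simp only [hsum, rmul_b_e, Finset.sum_ite_eq, Finset.mem_univ, if_true]

/-- The projection of the free bimodule of rank `n + 1` onto its direct summand `Qⁿ`. -/
def ofFree (n : ℕ) : (Fin (n + 1) → Env K s) →ₗ[Env K s] Q K s n :=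
  Fintype.linearCombination (Env K s) (bSum K s n)

theorem ofFree_apply (n : ℕ) (f : Fin (n + 1) → Env K s) :
    ofFree K s n f = ∑ j, f j • bSum K s n j :=
  rfl

/-- The inclusion of `Qⁿ` into the free bimodule of rank `n + 1`. -/
def toFree (n : ℕ) : Q K s n →ₗ[Env K s] (Fin (n + 1) → Env K s) :=
  DirectSum.toModule (Env K s) _ _ fun p =>
    LinearMap.single (Env K s) (fun _ => Env K s) p.2 ∘ₗ incl K s p.1 (p.1 + (n : ZMod s))

theorem toFree_b (n : ℕ) (i : ZMod s) (j : Fin (n + 1)) :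
    toFree K s n (b K s n i j) = Pi.single j (Env.tmul K s (e K s i) (e K s (i + n))) := by
  rw [toFree, b, DirectSum.toModule_lof, LinearMap.comp_apply, BiProj.gen, incl_tmul]
  rfl

theorem ofFree_comp_toFree (n : ℕ) : ofFree K s n ∘ₗ toFree K s n = LinearMap.id := by
  refine hom_ext_b fun i j => ?_
  have hfactor : Env.tmul K s (e K s i) (e K s (i + n)) =
      Env.tmul K s (e K s i) (e K s (i + n)) * Env.tmul K s (e K s i) 1 := by
    rw [Env.tmul_mul_tmul, e_mul_e, one_mul]
  rw [LinearMap.comp_apply, toFree_b, ofFree, Fintype.linearCombination_apply_single, hfactor,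
    mul_smul]
  exact (congrArg _ (lmul_e_bSum K s n i j)).trans (smul_b K s n i j)

theorem ofFree_toFree (n : ℕ) (z : Q K s n) : ofFree K s n (toFree K s n z) = z :=
  LinearMap.congr_fun (ofFree_comp_toFree K s n) z

theorem ofFree_surjective (n : ℕ) : Function.Surjective (ofFree K s n) :=
  fun z => ⟨toFree K s n z, ofFree_toFree K s n z⟩

instance (n : ℕ) : Module.Projective (Env K s) (Q K s n) :=
  Module.Projective.of_split (toFree K s n) (ofFree K s n) (ofFree_comp_toFree K s n)

instance (n : ℕ) : Module.Finite (Env K s) (Q K s n) :=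
  Module.Finite.of_surjective (ofFree K s n) (ofFree_surjective K s n)

end Free

section Differential

theorem d_bSum_eq_sum (n : ℕ) (j : Fin (n + 2)) :
    d K s n (bSum K s (n + 1) j) = ∑ i, dGen K s n i j := by
  simp only [bSum, map_sum, d_b]

theorem gradedComm_smul_bSum (n : ℕ) (a : Lam K s) (j : Fin (n + 1)) :
    gradedComm n a • bSum K s n j =
      ∑ i, (rmul K s (b K s n i j) a + (-1 : ℤ) ^ (n + 1) • lmul K s a (b K s n (i + 1) j)) := by
  have hshift : bSum K s n j = ∑ i, b K s n (i + 1) j :=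
    (Equiv.sum_comp (Equiv.addRight 1) fun i => b K s n i j).symm
  rw [gradedComm_smul, Finset.sum_add_distrib, ← Finset.smul_sum]
  congr 1
  · exact Finset.smul_sum
  · rw [hshift]
    exact congrArg _ Finset.smul_sum

theorem d_bSum_zero (n : ℕ) :
    d K s n (bSum K s (n + 1) 0) = gradedComm n (y K s) • bSum K s n 0 := by
  rw [d_bSum_eq_sum, gradedComm_smul_bSum]
  exact Finset.sum_congr rfl fun i _ => dif_pos rfl

theorem d_bSum_last (n : ℕ) :
    d K s n (bSum K s (n + 1) (Fin.last _)) = gradedComm n (x K s) • bSum K s n (Fin.last n) := by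
  rw [d_bSum_eq_sum, gradedComm_smul_bSum]
  refine Finset.sum_congr rfl fun i _ => ?_
  have h0 : (Fin.last (n + 1) : ℕ) ≠ 0 := Nat.succ_ne_zero n
  rw [dGen, dif_neg h0, dif_pos (Fin.val_last (n + 1))]
  rfl

theorem d_bSum_succ_castSucc (n : ℕ) (k : Fin n) :
    d K s n (bSum K s (n + 1) k.succ.castSucc) =
      gradedComm n (x K s) • bSum K s n k.castSucc +
        gradedComm n (y K s) • bSum K s n k.succ := by
  rw [d_bSum_eq_sum, gradedComm_smul_bSum, gradedComm_smul_bSum, ← Finset.sum_add_distrib]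
  refine Finset.sum_congr rfl fun i _ => ?_
  have h0 : (k.succ.castSucc : ℕ) ≠ 0 := Nat.succ_ne_zero k
  have hlast : (k.succ.castSucc : ℕ) ≠ n + 1 := (Nat.succ_lt_succ k.isLt).ne
  rw [dGen, dif_neg h0, dif_neg hlast, smul_add, add_comm (_ • lmul K s (y K s) _),
    add_add_add_comm]
  rfl

theorem d_ofFree (n : ℕ) (f : Fin (n + 2) → Env K s) :
    d K s n (ofFree K s (n + 1) f) =
      ofFree K s n (koszulMap (gradedComm n (x K s)) (gradedComm n (y K s)) (n + 1) f) := by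
  simp only [ofFree_apply, map_sum, map_smul, koszulMap_apply, add_smul, mul_smul,
    Finset.sum_add_distrib]
  rw [Fin.sum_univ_succ, Fin.sum_univ_castSucc, d_bSum_zero, Fin.succ_last, d_bSum_last,
    Fin.sum_univ_castSucc, Fin.sum_univ_succ (fun k : Fin (n + 1) => f k.castSucc • _)]
  simp only [Fin.succ_castSucc, d_bSum_succ_castSucc, smul_add, Finset.sum_add_distrib,
    Fin.succ_last, Fin.castSucc_zero]
  abel

/-- The idempotent `∑ e_i ⊗ e_{i+n}`, by which `ofFree` followed by `toFree` multiplies every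
coordinate. -/
def diag (n : ℕ) : Env K s := ∑ i, Env.tmul K s (e K s i) (e K s (i + (n : ZMod s)))

theorem toFree_ofFree (n : ℕ) (f : Fin (n + 1) → Env K s) (j : Fin (n + 1)) :
    toFree K s n (ofFree K s n f) j = f j * diag K s n := by
  have hb (k : Fin (n + 1)) : toFree K s n (bSum K s n k) = Pi.single k (diag K s n) := by
    simp only [bSum, map_sum, toFree_b, diag]
    exact (map_sum (AddMonoidHom.single (fun _ : Fin (n + 1) => Env K s) k) _ _).symm
  rw [ofFree_apply, map_sum, Finset.sum_apply, Finset.sum_eq_single j]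
  · rw [map_smul, hb, Pi.smul_apply, Pi.single_eq_same, smul_eq_mul]
  · intro k _ hkj
    rw [map_smul, hb, Pi.smul_apply, Pi.single_eq_of_ne hkj.symm, smul_zero]
  · exact fun hj => absurd (Finset.mem_univ j) hj

theorem diag_mul_gradedComm (n : ℕ) {a : Lam K s} (ha : ∀ i, e K s i * a = a * e K s (i + 1)) :
    diag K s (n + 1) * gradedComm n a = gradedComm n a * diag K s n := by
  have hcast (i : ZMod s) : i + ((n + 1 : ℕ) : ZMod s) = i + n + 1 := by
    rw [Nat.cast_succ, add_assoc]
  have hright : diag K s (n + 1) * Env.tmul K s 1 a = Env.tmul K s 1 a * diag K s n := by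
    simp only [diag, Finset.sum_mul, Finset.mul_sum, Env.tmul_mul_tmul, one_mul, mul_one, ha, hcast]
  have hleft : diag K s (n + 1) * Env.tmul K s a 1 = Env.tmul K s a 1 * diag K s n := by
    simp only [diag, Finset.sum_mul, Finset.mul_sum, Env.tmul_mul_tmul, one_mul, mul_one, ha,
      hcast, add_right_comm _ (n : ZMod s)]
    exact Equiv.sum_comp (Equiv.addRight 1)
      fun i => Env.tmul K s (a * e K s i) (e K s (i + (n : ZMod s)))
  rw [gradedComm, mul_add, add_mul, mul_smul_comm, smul_mul_assoc, hright, hleft]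

theorem toFree_d (n : ℕ) (z : Q K s (n + 1)) :
    toFree K s n (d K s n z) =
      koszulMap (gradedComm n (x K s)) (gradedComm n (y K s)) (n + 1) (toFree K s (n + 1) z) := by
  obtain ⟨f, rfl⟩ := ofFree_surjective K s (n + 1) z
  ext j
  simp only [d_ofFree, toFree_ofFree, koszulMap_apply, mul_assoc, add_mul,
    diag_mul_gradedComm K s n (e_mul_x K s), diag_mul_gradedComm K s n (e_mul_y K s)]

end Differential

section Exactness

theorem exact_d_d (n : ℕ) : Function.Exact (d K s (n + 1)) (d K s n) := by
  have hfree := exact_koszulMap_gradedComm (K := K) (s := s) n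
  intro z
  constructor
  · intro hz
    obtain ⟨g, hg⟩ := (hfree (toFree K s (n + 1) z)).1 (by rw [← toFree_d, hz, map_zero])
    exact ⟨ofFree K s (n + 2) g, by rw [d_ofFree, hg, ofFree_toFree]⟩
  · rintro ⟨w, rfl⟩
    obtain ⟨f, rfl⟩ := ofFree_surjective K s (n + 2) w
    rw [d_ofFree, d_ofFree, hfree.apply_apply_eq_zero, map_zero]

theorem d0_bSum : d0 K s (bSum K s 0 0) = 1 := by
  rw [bSum, map_sum, ← (relations K s).complete]
  refine Finset.sum_congr rfl fun i _ => ?_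
  rw [d0, b, DirectSum.toModule_lof, homOf_gen, Env.tmul_smul, mul_one, Nat.cast_zero, add_zero,
    e_mul_e]

theorem d0_surjective : Function.Surjective (d0 K s) := fun a =>
  ⟨Env.tmul K s a 1 • bSum K s 0 0, by
    rw [map_smul, d0_bSum, Env.tmul_smul, mul_one, mul_one]⟩

theorem exists_smul_bSum (z : Q K s 0) : ∃ c : Env K s, c • bSum K s 0 0 = z := by
  obtain ⟨f, rfl⟩ := ofFree_surjective K s 0 z
  exact ⟨f 0, by rw [ofFree_apply, Fin.sum_univ_one]⟩

theorem gradedComm_zero (a : Lam K s) :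
    gradedComm 0 a = Env.tmul K s 1 a - Env.tmul K s a 1 := by
  rw [gradedComm, zero_add, pow_one, neg_one_smul, sub_eq_add_neg]

theorem gradedComm_zero_smul_one (a : Lam K s) : gradedComm 0 a • (1 : Lam K s) = 0 := by
  simp only [gradedComm_zero, sub_smul, Env.tmul_smul, one_mul, mul_one, sub_self]

theorem gradedComm_zero_smul_bSum_mem_range (a : Lam K s) :
    gradedComm 0 a • bSum K s 0 0 ∈ LinearMap.range (d K s 0) := by
  induction a using Lam.induction with
  | he k =>
    have hright : rmul K s (bSum K s 0 0) (e K s k) = b K s 0 k 0 := by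
      simpa only [Nat.cast_zero, add_zero] using rmul_bSum_e K s 0 k 0
    have hcomm : gradedComm 0 (e K s k) • bSum K s 0 0 = 0 := by
      rw [gradedComm_zero, sub_smul]
      exact sub_eq_zero.2 (hright.trans (lmul_e_bSum K s 0 k 0).symm)
    exact hcomm ▸ zero_mem _
  | hx => exact ⟨_, d_bSum_last K s 0⟩
  | hy => exact ⟨_, d_bSum_zero K s 0⟩
  | hadd a a' ha ha' =>
    convert add_mem ha ha' using 1
    rw [← add_smul]
    simp only [gradedComm_zero, Env.tmul_add, Env.add_tmul]
    rw [add_sub_add_comm]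
  | hsmul c a ha =>
    convert Submodule.smul_mem _ (algebraMap K (Env K s) c) ha using 1
    rw [smul_smul, ← Algebra.smul_def]
    simp only [gradedComm_zero, Env.tmul_smul_right, Env.tmul_smul_left, smul_sub]
  | hmul a a' ha ha' =>
    convert add_mem (Submodule.smul_mem _ (Env.tmul K s 1 a') ha)
      (Submodule.smul_mem _ (Env.tmul K s a 1) ha') using 1
    rw [smul_smul, smul_smul, ← add_smul]
    simp only [gradedComm_zero, mul_sub, Env.tmul_mul_tmul, one_mul, mul_one]
    rw [sub_add_sub_cancel]

theorem smul_bSum_sub_mem_range (c : Env K s) :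
    c • bSum K s 0 0 - Env.tmul K s (c • (1 : Lam K s)) 1 • bSum K s 0 0 ∈
      LinearMap.range (d K s 0) := by
  induction c using Env.induction with
  | h0 => simp only [zero_smul, Env.zero_tmul, sub_self, zero_mem]
  | hadd c c' hc hc' =>
    convert add_mem hc hc' using 1
    simp only [add_smul, Env.add_tmul]
    abel
  | htmul u w =>
    convert Submodule.smul_mem _ (Env.tmul K s u 1)
      (gradedComm_zero_smul_bSum_mem_range K s w) using 1
    rw [← sub_smul, smul_smul, gradedComm_zero, mul_sub]
    simp only [Env.tmul_mul_tmul, Env.tmul_smul, mul_one]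

theorem exact_d_d0 : Function.Exact (d K s 0) (d0 K s) := by
  intro z
  constructor
  · intro hz
    obtain ⟨c, rfl⟩ := exists_smul_bSum K s z
    have hc := smul_bSum_sub_mem_range K s c
    rw [map_smul, d0_bSum] at hz
    rwa [hz, Env.zero_tmul, zero_smul, sub_zero] at hc
  · rintro ⟨w, rfl⟩
    obtain ⟨f, rfl⟩ := ofFree_surjective K s 1 w
    rw [d_ofFree, ofFree_apply, Fin.sum_univ_one, map_smul, d0_bSum, koszulMap_apply, add_smul,
      mul_smul, mul_smul, gradedComm_zero_smul_one, gradedComm_zero_smul_one, smul_zero, smul_zero,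
      add_zero]

end Exactness

section Minimality

theorem range_d_le_jacobson (n : ℕ) :
    LinearMap.range (d K s n) ≤ Module.jacobson (Env K s) (Q K s n) := by
  rintro _ ⟨w, rfl⟩
  obtain ⟨f, rfl⟩ := ofFree_surjective K s (n + 1) w
  rw [d_ofFree, ofFree_apply]
  refine sum_mem fun j _ => Ring.jacobson_smul_top_le _ _
    (Submodule.smul_mem_smul ?_ Submodule.mem_top)
  exact add_mem (Ideal.mul_mem_left _ _ (gradedComm_mem_jacobson n (x_mul_mul_x K s)))
    (Ideal.mul_mem_left _ _ (gradedComm_mem_jacobson n (y_mul_mul_y K s)))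

theorem isSuperfluous_of_le_range_d (n : ℕ) {L : Submodule (Env K s) (Q K s n)}
    (hL : L ≤ LinearMap.range (d K s n)) : IsSuperfluous L :=
  .of_le_jacobson (hL.trans (range_d_le_jacobson K s n))

end Minimality

end Lam

end

theorem theorem2p6_general (K : Type*) [Field K] (s : ℕ) [NeZero s] :
    IsMinimalProjectiveResolution (R := Lam.Env K s) (M := Lam K s) (P := Lam.Q K s)
      (Lam.d0 K s) (Lam.d K s) where
  exact_zero := Lam.exact_d_d0 K s
  exact_succ := Lam.exact_d_d K s
  cover_zero :=
    { projective := inferInstance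
      surjective := Lam.d0_surjective K s
      superfluous := Lam.isSuperfluous_of_le_range_d K s 0
        (LinearMap.exact_iff.1 (Lam.exact_d_d0 K s)).le }
  cover_succ n :=
    { projective := inferInstance
      surjective := LinearMap.surjective_rangeRestrict _
      superfluous := Lam.isSuperfluous_of_le_range_d K s (n + 1) (by
        rw [LinearMap.ker_rangeRestrict]
        exact (LinearMap.exact_iff.1 (Lam.exact_d_d K s n)).le) }

theorem theorem2p6 (K : Type*) [Field K] [IsAlgClosed K] (s : ℕ) [NeZero s] :
    IsMinimalProjectiveResolution (R := Lam.Env K s) (M := Lam K s) (P := Lam.Q K s)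
      (Lam.d0 K s) (Lam.d K s) :=
  theorem2p6_general K s
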